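/- Let $B_m$ denote the closed unit ball of $\mathbb{R}^m$ with the Euclidean norm $\|\cdot\|$. For $k,\ell\in\mathbb{N}$ and $L\ge 0$ let $\mathcal{H}_L$ be the set of all $L$-Lipschitz maps $h:B_k\to B_\ell$. For a Borel probability measure $P$ on $B_k\times B_\ell$ and a sample $S=((x_i,y_i))_{i=1}^n$ put $$R(h)=\mathbb{E}_{(x,y)\sim P}\,\|h(x)-y\|,\qquad \hat R_n(h)=\frac1n\sum_{i=1}^n\|h(x_i)-y_i\|,\qquad Q_n(k,\ell,L)=\sup_{h\in\mathcal{H}_L}\bigl|R(h)-\hat R_n(h)\bigr| .$$ There is an absolute constant $C>0$ such that for all $k,\ell\ge 0$, all $L\ge 0$, all $n\ge 1$, every Borel probability measure $P$ on $B_k\times B_\ell$ and every $\delta\in(0,1)$, if $S$ consists of $n$ independent draws from $P$, then with probability at least $1-\delta$ $$Q_n(k,\ell,L)\;\le\; C\,\frac{\max(L,1)}{n^{1/(d+1)}}+6\sqrt{\frac{\ln(2/\delta)}{2n}},\qquad d=k+\ell .$$ In particular, for $L\ge 1$, the first term is $C\,L/n^{1/(d+1)}$. -/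

import Mathlib

open MeasureTheory
open scoped NNReal ENNReal

/-- The closed Euclidean unit ball of `ℝ^m`, as a metric and measurable (Borel) subspace. -/
abbrev UnitBall (m : ℕ) : Type :=
  Metric.closedBall (0 : EuclideanSpace ℝ (Fin m)) 1

/-- The hypothesis class: all `L`-Lipschitz maps from the unit ball of `ℝ^k` to that of `ℝ^ℓ`. -/
def lipClass (k ℓ : ℕ) (L : ℝ≥0) : Set (UnitBall k → UnitBall ℓ) :=
  {h | LipschitzWith L h}

/-- The loss `f_h (x, y) = ‖h x - y‖`. -/
noncomputable def lossFn {k ℓ : ℕ} (h : UnitBall k → UnitBall ℓ)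
    (z : UnitBall k × UnitBall ℓ) : ℝ :=
  ‖(h z.1 : EuclideanSpace ℝ (Fin ℓ)) - (z.2 : EuclideanSpace ℝ (Fin ℓ))‖

/-- The risk `R(h)`, the expected loss under `P`. -/
noncomputable def risk {k ℓ : ℕ} (P : Measure (UnitBall k × UnitBall ℓ))
    (h : UnitBall k → UnitBall ℓ) : ℝ :=
  ∫ z, lossFn h z ∂P

/-- The empirical risk on a labeled sample `S` of size `n`. -/
noncomputable def empRisk {k ℓ n : ℕ} (S : Fin n → UnitBall k × UnitBall ℓ)
    (h : UnitBall k → UnitBall ℓ) : ℝ :=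
  (n : ℝ)⁻¹ * ∑ i, lossFn h (S i)

/-- The uniform deviation `sup_h |R(h) - R_n(h)|` over the `L`-Lipschitz maps `h`,
as a function of the sample `S`. The supremum is over a nonempty set
(`lipClass_nonempty`) that is bounded above (`bddAbove_deviation`). -/
noncomputable def uniformDeviation {k ℓ n : ℕ} (P : Measure (UnitBall k × UnitBall ℓ))
    (L : ℝ≥0) (S : Fin n → UnitBall k × UnitBall ℓ) : ℝ :=
  sSup ((fun h => |risk P h - empRisk S h|) '' lipClass k ℓ L)

theorem lipClass_nonempty (k ℓ : ℕ) (L : ℝ≥0) : (lipClass k ℓ L).Nonempty :=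
  ⟨fun _ => ⟨0, by simp⟩, (LipschitzWith.const (⟨0, by simp⟩ : UnitBall ℓ)).weaken zero_le⟩

theorem lossFn_nonneg {k ℓ : ℕ} (h : UnitBall k → UnitBall ℓ)
    (z : UnitBall k × UnitBall ℓ) : 0 ≤ lossFn h z :=
  norm_nonneg _

theorem lossFn_le_two {k ℓ : ℕ} (h : UnitBall k → UnitBall ℓ)
    (z : UnitBall k × UnitBall ℓ) : lossFn h z ≤ 2 := by
  have h1 := (h z.1).2
  have h2 := z.2.2
  rw [mem_closedBall_zero_iff] at h1 h2
  exact (norm_sub_le _ _).trans (by linarith)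

theorem integrable_lossFn {k ℓ : ℕ} (P : Measure (UnitBall k × UnitBall ℓ))
    [IsProbabilityMeasure P] {L : ℝ≥0} {h : UnitBall k → UnitBall ℓ}
    (hh : h ∈ lipClass k ℓ L) : Integrable (lossFn h) P := by
  have hc : Continuous (lossFn h) := by
    have hcont : Continuous h := LipschitzWith.continuous hh
    unfold lossFn
    fun_prop
  refine Integrable.of_bound hc.aestronglyMeasurable 2 (ae_of_all _ fun z => ?_)
  rw [Real.norm_of_nonneg (lossFn_nonneg h z)]
  exact lossFn_le_two h z

theorem bddAbove_deviation {k ℓ n : ℕ} (P : Measure (UnitBall k × UnitBall ℓ))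
    [IsProbabilityMeasure P] (L : ℝ≥0) (S : Fin n → UnitBall k × UnitBall ℓ) :
    BddAbove ((fun h => |risk P h - empRisk S h|) '' lipClass k ℓ L) := by
  refine ⟨2, ?_⟩
  rintro _ ⟨h, hh, rfl⟩
  have r0 : 0 ≤ risk P h := integral_nonneg (lossFn_nonneg h)
  have r2 : risk P h ≤ 2 := by
    have := integral_mono (integrable_lossFn P hh) (integrable_const (2 : ℝ)) (lossFn_le_two h)
    simpa [risk] using this
  have e0 : 0 ≤ empRisk S h :=
    mul_nonneg (by positivity) (Finset.sum_nonneg fun i _ => lossFn_nonneg h (S i))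
  have e2 : empRisk S h ≤ 2 := by
    have hs : ∑ i, lossFn h (S i) ≤ (n : ℝ) * 2 := by
      have := Finset.sum_le_sum fun i (_ : i ∈ Finset.univ) => lossFn_le_two h (S i)
      simpa using this
    rcases Nat.eq_zero_or_pos n with rfl | hn
    · simp [empRisk]
    · have hn' : (0 : ℝ) < n := by exact_mod_cast hn
      rw [empRisk, inv_mul_le_iff₀ hn']
      exact hs
  exact abs_sub_le_iff.mpr ⟨by linarith, by linarith⟩

/-! The deviation is bounded by its mean plus a fluctuation. Replacing one sample point moves it by
at most `2 / n`, so McDiarmid's inequality (`measureReal_ge_le_of_bounded_differences`) controls the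
fluctuation.

For the mean, every loss is `2 * max L 1`-Lipschitz on a product of balls, and the bound holds for
all such functions at once. The chaining quantizes the domain, not the function class: `f` is
telescoped along nets of scale `4⁻ʲ`. Each increment is constant on the cells of a partition and of
size `O(4⁻ʲ)` times the Lipschitz constant, so its deviation is at most that size times the `ℓ¹`
distance between the true and empirical cell masses. This distance does not depend on `f` and has
mean at most `√(N / n)` for `N` cells (`integral_sum_abs_meanDeviation_le`).

With `m = n ^ (1 / (d + 1))` and scales down to about `1 / m`, the level-`j` term is `O(2⁻ʲ / m)`
with an absolute constant (`sqrt_card_div_le`). The series and the final quantization error are thus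
both `O(1 / m)`. -/

/-! ### Nets of Euclidean balls -/

/-- Volume bound for `ε`-separated finite subsets of the closed Euclidean unit ball. -/
theorem card_le_of_separated_unitBall {m : ℕ} {ε : ℝ} (hε : 0 < ε) (hε1 : ε ≤ 1)
    (s : Finset (UnitBall m)) (hs : ∀ c ∈ s, ∀ d ∈ s, c ≠ d → ε < dist c d) :
    (s.card : ℝ) ≤ (3 / ε) ^ m := by
  let μ : Measure (EuclideanSpace ℝ (Fin m)) := volume
  have hδ : 0 < ε / 2 := by positivity
  have hρ : (0 : ℝ) < 1 + ε / 2 := by positivity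
  -- Balls of radius `ε / 2` about separated points are disjoint and lie in the ball of radius `1 +
  -- ε / 2`; compare volumes.
  set A : Set (EuclideanSpace ℝ (Fin m)) := ⋃ c ∈ s, Metric.ball (c : EuclideanSpace ℝ (Fin m)) (ε / 2) with hA
  have D : Set.Pairwise (s : Set (UnitBall m))
      (Function.onFun Disjoint fun c => Metric.ball (c : EuclideanSpace ℝ (Fin m)) (ε / 2)) := by
    rintro c hc d hd hcd
    apply Metric.ball_disjoint_ball
    have := hs c hc d hd hcd
    rw [Subtype.dist_eq] at this
    linarith
  have A_subset : A ⊆ Metric.ball (0 : EuclideanSpace ℝ (Fin m)) (1 + ε / 2) := by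
    refine Set.iUnion₂_subset fun x _ => Metric.ball_subset_ball' ?_
    have := x.2
    rw [Metric.mem_closedBall] at this
    linarith
  have I : (s.card : ℝ≥0∞) * ENNReal.ofReal ((ε / 2) ^ m) * μ (Metric.ball 0 1) ≤
      ENNReal.ofReal ((1 + ε / 2) ^ m) * μ (Metric.ball 0 1) := by
    calc
      _ = μ A := by
        rw [hA, measure_biUnion_finset D fun c _ => measurableSet_ball]
        simp only [μ.addHaar_ball_of_pos _ hδ, finrank_euclideanSpace_fin]
        simp only [Finset.sum_const, nsmul_eq_mul, mul_assoc]
      _ ≤ μ (Metric.ball (0 : EuclideanSpace ℝ (Fin m)) (1 + ε / 2)) := measure_mono A_subset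
      _ = _ := by simp only [μ.addHaar_ball_of_pos _ hρ, finrank_euclideanSpace_fin]
  have J : (s.card : ℝ≥0∞) * ENNReal.ofReal ((ε / 2) ^ m) ≤ ENNReal.ofReal ((1 + ε / 2) ^ m) :=
    (ENNReal.mul_le_mul_iff_left (Metric.measure_ball_pos _ _ zero_lt_one).ne'
      measure_ball_lt_top.ne).1 I
  have K : (s.card : ℝ) * (ε / 2) ^ m ≤ (1 + ε / 2) ^ m := by
    have := ENNReal.toReal_le_of_le_ofReal (by positivity) J
    rwa [ENNReal.toReal_mul, ENNReal.toReal_natCast, ENNReal.toReal_ofReal (by positivity)] at this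
  rw [← le_div_iff₀ (by positivity), ← div_pow] at K
  refine K.trans (pow_le_pow_left₀ (by positivity) ?_ m)
  rw [div_le_div_iff₀ hδ hε]
  nlinarith

/-- The unit ball of `ℝ^m` has an `ε`-net of cardinality at most `(3 / ε) ^ m`. -/
theorem exists_net_unitBall (m : ℕ) {ε : ℝ} (hε : 0 < ε) (hε1 : ε ≤ 1) :
    ∃ T : Finset (UnitBall m), (T.card : ℝ) ≤ (3 / ε) ^ m ∧ ∀ x, ∃ t ∈ T, dist x t ≤ ε := by
  classical
  -- A separated set of maximal cardinality is a net: an uncovered point could be added to it.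
  let N : Set ℕ := {N | ∃ T : Finset (UnitBall m),
    (∀ c ∈ T, ∀ d ∈ T, c ≠ d → ε < dist c d) ∧ T.card = N}
  have hne : N.Nonempty := ⟨0, ∅, by simp, by simp⟩
  have hbdd : BddAbove N := by
    refine ⟨⌊(3 / ε) ^ m⌋₊, ?_⟩
    rintro _ ⟨T, hT, rfl⟩
    exact Nat.le_floor (card_le_of_separated_unitBall hε hε1 T hT)
  obtain ⟨T, hT, hcard⟩ := Nat.sSup_mem hne hbdd
  refine ⟨T, card_le_of_separated_unitBall hε hε1 T hT, fun x => ?_⟩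
  by_contra! hx
  have hxT : x ∉ T := fun h => by
    have := hx x h
    rw [dist_self] at this
    linarith
  have hmem : (insert x T).card ∈ N := by
    refine ⟨insert x T, ?_, rfl⟩
    intro c hc d hd hcd
    rw [Finset.mem_insert] at hc hd
    rcases hc with rfl | hc <;> rcases hd with rfl | hd
    · exact absurd rfl hcd
    · exact hx d hd
    · rw [dist_comm]; exact hx c hc
    · exact hT c hc d hd hcd
  have := le_csSup hbdd hmem
  rw [Finset.card_insert_of_notMem hxT] at this
  omega

/-- A product of two unit balls, with the supremum metric, has an `ε`-net of cardinality at most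
`(3 / ε) ^ (k + ℓ)`. -/
theorem exists_net_prod_unitBall (k ℓ : ℕ) {ε : ℝ} (hε : 0 < ε) (hε1 : ε ≤ 1) :
    ∃ T : Finset (UnitBall k × UnitBall ℓ), (T.card : ℝ) ≤ (3 / ε) ^ (k + ℓ) ∧
      ∀ x, ∃ t ∈ T, dist x t ≤ ε := by
  obtain ⟨T₁, h₁, c₁⟩ := exists_net_unitBall k hε hε1
  obtain ⟨T₂, h₂, c₂⟩ := exists_net_unitBall ℓ hε hε1
  refine ⟨T₁ ×ˢ T₂, ?_, fun x => ?_⟩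
  · rw [Finset.card_product, Nat.cast_mul, pow_add]
    exact mul_le_mul h₁ h₂ (by positivity) (by positivity)
  · obtain ⟨t₁, m₁, d₁⟩ := c₁ x.1
    obtain ⟨t₂, m₂, d₂⟩ := c₂ x.2
    exact ⟨(t₁, t₂), Finset.mk_mem_product m₁ m₂, max_le d₁ d₂⟩

/-! ### McDiarmid's inequality -/

theorem integral_pi_fin_succ {X : Type*} [MeasurableSpace X] (P : Measure X)
    [IsProbabilityMeasure P] {n : ℕ} {G : (Fin (n + 1) → X) → ℝ} (hG : Measurable G)
    {M : ℝ} (hM : ∀ S, |G S| ≤ M) :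
    ∫ S, G S ∂(Measure.pi fun _ : Fin (n + 1) => P)
      = ∫ x, ∫ S, G (Fin.cons x S) ∂(Measure.pi fun _ : Fin n => P) ∂P := by
  have h := ((measurePreserving_piFinSuccAbove (fun _ : Fin (n + 1) => P) 0).symm).integral_comp' G
  rw [← h, integral_prod]
  · simp [MeasurableEquiv.piFinSuccAbove, Fin.insertNthEquiv]
  · refine Integrable.of_bound
      (hG.comp (MeasurableEquiv.measurable _)).aestronglyMeasurable M (ae_of_all _ fun z => ?_)
    exact hM _

theorem measurable_fin_cons {X : Type*} [MeasurableSpace X] {n : ℕ} :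
    Measurable fun z : X × (Fin n → X) => (Fin.cons z.1 z.2 : Fin (n + 1) → X) := by
  refine measurable_pi_lambda _ fun i => ?_
  refine Fin.cases ?_ (fun j => ?_) i
  · simpa using measurable_fst
  · simp only [Fin.cons_succ]
    exact (measurable_pi_apply j).comp measurable_snd

theorem abs_integral_le_of_abs_le {Ω : Type*} [MeasurableSpace Ω] (μ : Measure Ω)
    [IsProbabilityMeasure μ] {f : Ω → ℝ} {M : ℝ} (hf : ∀ x, |f x| ≤ M) : |∫ x, f x ∂μ| ≤ M := by
  have h : ∀ x, ‖f x‖ ≤ M := hf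
  simpa using norm_integral_le_of_norm_le_const (μ := μ) (ae_of_all _ h)

/-- Exponential moment bound for functions of independent variables with bounded differences. -/
theorem integral_exp_le_of_bounded_differences {X : Type*} [MeasurableSpace X] (P : Measure X)
    [IsProbabilityMeasure P] {c : ℝ} (hc : 0 ≤ c) (t : ℝ) (n : ℕ) :
    ∀ (G : (Fin n → X) → ℝ) (M : ℝ), Measurable G → (∀ S, |G S| ≤ M) →
      (∀ S i x, |G (Function.update S i x) - G S| ≤ c) →
      ∫ S, Real.exp (t * (G S - ∫ S', G S' ∂(Measure.pi fun _ : Fin n => P)))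
          ∂(Measure.pi fun _ : Fin n => P)
        ≤ Real.exp (n * ((c / 2) ^ 2 * t ^ 2 / 2)) := by
  induction n with
  | zero =>
    intro G M _ _ _
    have h : ∀ S, G S = G default := fun S => congrArg G (Subsingleton.elim _ _)
    simp [h]
  | succ n ih =>
    intro G M hG hM hd
    set μ : Measure (Fin n → X) := Measure.pi fun _ : Fin n => P with hμ
    -- `g` is the conditional expectation of `G` given the first coordinate. Induction handles `G -
    -- g` for a fixed first coordinate, and Hoeffding's lemma handles `g` minus its mean.
    set g : X → ℝ := fun x => ∫ S, G (Fin.cons x S) ∂μ with hg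
    have hGc : Measurable fun z : X × (Fin n → X) => G (Fin.cons z.1 z.2) :=
      hG.comp measurable_fin_cons
    have hGx : ∀ x, Measurable fun S : Fin n → X => G (Fin.cons x S) := fun x =>
      hGc.comp measurable_prodMk_left
    have hGi : ∀ x, Integrable (fun S : Fin n → X => G (Fin.cons x S)) μ := fun x =>
      Integrable.of_bound (hGx x).aestronglyMeasurable M (ae_of_all _ fun S => hM _)
    have hgm : Measurable g := (hGc.stronglyMeasurable.integral_prod_right).measurable
    have hgM : ∀ x, |g x| ≤ M := fun x =>
      abs_integral_le_of_abs_le μ fun S => hM (Fin.cons x S)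
    have hosc : ∀ x y, g x - g y ≤ c := by
      intro x y
      rw [hg]
      simp only
      rw [← integral_sub (hGi x) (hGi y)]
      have := integral_mono ((hGi x).sub (hGi y)) (integrable_const c) (fun S => by
        have h := hd (Fin.cons y S) 0 x
        rw [Fin.update_cons_zero] at h
        exact (le_abs_self _).trans h)
      simpa using this
    have hEG : ∫ S, G S ∂(Measure.pi fun _ : Fin (n + 1) => P) = ∫ x, g x ∂P :=
      integral_pi_fin_succ P hG hM
    have hexpb : ∀ a b : ℝ, |a| ≤ M → |b| ≤ M →
        |Real.exp (t * (a - b))| ≤ Real.exp (|t| * (2 * M)) := by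
      intro a b ha hb
      rw [Real.abs_exp, Real.exp_le_exp]
      calc t * (a - b) ≤ |t * (a - b)| := le_abs_self _
        _ = |t| * |a - b| := abs_mul _ _
        _ ≤ |t| * (2 * M) := by
          gcongr
          rw [abs_le] at *
          constructor <;> linarith
    have hEgM : |∫ x, g x ∂P| ≤ M := abs_integral_le_of_abs_le P hgM
    rw [hEG, integral_pi_fin_succ P (by fun_prop) (fun S => hexpb _ _ (hM S) hEgM)]
    have hinner : ∀ x, ∫ S, Real.exp (t * (G (Fin.cons x S) - ∫ x, g x ∂P)) ∂μ
        ≤ Real.exp (n * ((c / 2) ^ 2 * t ^ 2 / 2)) * Real.exp (t * (g x - ∫ x, g x ∂P)) := by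
      intro x
      have h1 := ih (fun S => G (Fin.cons x S)) M (hGx x) (fun S => hM _) (fun S i y => by
        have := hd (Fin.cons x S) i.succ y
        rwa [← Fin.cons_update] at this)
      have h2 : ∀ S, Real.exp (t * (G (Fin.cons x S) - ∫ x, g x ∂P))
          = Real.exp (t * (G (Fin.cons x S) - g x)) * Real.exp (t * (g x - ∫ x, g x ∂P)) := by
        intro S
        rw [← Real.exp_add]
        ring_nf
      simp_rw [h2]
      rw [integral_mul_const]
      exact mul_le_mul_of_nonneg_right h1 (Real.exp_pos _).le
    have hHoeff : ∫ x, Real.exp (t * (g x - ∫ x, g x ∂P)) ∂P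
        ≤ Real.exp ((c / 2) ^ 2 * t ^ 2 / 2) := by
      have : Nonempty X := nonempty_of_isProbabilityMeasure P
      have hbdd : BddBelow (Set.range g) := ⟨-M, by
        rintro _ ⟨x, rfl⟩
        exact (abs_le.1 (hgM x)).1⟩
      -- Oscillation at most `c` puts `g` in an interval of length `c` starting at its infimum,
      -- which gives the variance proxy `(c / 2) ^ 2`.
      have h := (ProbabilityTheory.hasSubgaussianMGF_of_mem_Icc (μ := P) (X := g)
        (a := ⨅ x, g x) (b := (⨅ x, g x) + c) hgm.aemeasurable (ae_of_all _ fun x =>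
          ⟨ciInf_le hbdd x, by
            have : g x - c ≤ ⨅ x, g x := le_ciInf fun y => by linarith [hosc x y]
            linarith⟩)).mgf_le t
      simpa [ProbabilityTheory.mgf, abs_of_nonneg hc] using h
    calc ∫ x, ∫ S, Real.exp (t * (G (Fin.cons x S) - ∫ x, g x ∂P)) ∂μ ∂P
        ≤ ∫ x, Real.exp (n * ((c / 2) ^ 2 * t ^ 2 / 2)) *
            Real.exp (t * (g x - ∫ x, g x ∂P)) ∂P := by
          refine integral_mono_of_nonneg
            (ae_of_all _ fun x => integral_nonneg fun S => (Real.exp_pos _).le) ?_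
            (ae_of_all _ hinner)
          refine Integrable.const_mul (Integrable.of_bound (C := Real.exp (|t| * (2 * M)))
            (by fun_prop) (ae_of_all _ fun x => hexpb _ _ (hgM x) hEgM)) _
      _ = Real.exp (n * ((c / 2) ^ 2 * t ^ 2 / 2)) *
            ∫ x, Real.exp (t * (g x - ∫ x, g x ∂P)) ∂P := integral_const_mul _ _
      _ ≤ Real.exp (n * ((c / 2) ^ 2 * t ^ 2 / 2)) * Real.exp ((c / 2) ^ 2 * t ^ 2 / 2) := by
          gcongr
      _ = _ := by
          rw [← Real.exp_add]
          push_cast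
          ring_nf

/-- **McDiarmid's inequality** (bounded differences inequality) for i.i.d. samples. -/
theorem measureReal_ge_le_of_bounded_differences {X : Type*} [MeasurableSpace X] (P : Measure X)
    [IsProbabilityMeasure P] {c : ℝ} (hc : 0 ≤ c) {n : ℕ} {G : (Fin n → X) → ℝ} {M : ℝ}
    (hG : Measurable G) (hM : ∀ S, |G S| ≤ M)
    (hd : ∀ S i x, |G (Function.update S i x) - G S| ≤ c) {ε : ℝ} (hε : 0 ≤ ε) :
    (Measure.pi fun _ : Fin n => P).real
        {S | ε ≤ G S - ∫ S', G S' ∂(Measure.pi fun _ : Fin n => P)}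
      ≤ Real.exp (-ε ^ 2 / (2 * (n * (c / 2) ^ 2))) := by
  set μ := Measure.pi fun _ : Fin n => P
  have hEM : |∫ S, G S ∂μ| ≤ M := abs_integral_le_of_abs_le μ hM
  have hsub : ProbabilityTheory.HasSubgaussianMGF (fun S => G S - ∫ S', G S' ∂μ)
      ⟨n * (c / 2) ^ 2, by positivity⟩ μ := by
    refine ⟨fun t => ?_, fun t => ?_⟩
    · refine ProbabilityTheory.integrable_exp_mul_of_mem_Icc (a := -(2 * M)) (b := 2 * M)
        (by fun_prop) (ae_of_all _ fun S => ?_)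
      have := hM S
      rw [abs_le] at *
      constructor <;> linarith
    · refine (integral_exp_le_of_bounded_differences P hc t n G M hG hM hd).trans_eq ?_
      change _ = Real.exp (n * (c / 2) ^ 2 * t ^ 2 / 2)
      ring_nf
  exact hsub.measure_ge_le hε

/-! ### Empirical means on a finite partition -/

/-- The difference between the expectation of `f` and its empirical mean over a sample. -/
noncomputable def meanDeviation {X : Type*} [MeasurableSpace X] {n : ℕ} (P : Measure X)
    (S : Fin n → X) (f : X → ℝ) : ℝ :=
  ∫ x, f x ∂P - (n : ℝ)⁻¹ * ∑ i, f (S i)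

theorem abs_empirical_mean_le {X : Type*} {n : ℕ} (hn : 0 < n) (S : Fin n → X) {f : X → ℝ} {M : ℝ}
    (hf : ∀ x, |f x| ≤ M) : |(n : ℝ)⁻¹ * ∑ i, f (S i)| ≤ M := by
  have hn' : (0 : ℝ) < n := by exact_mod_cast hn
  rw [abs_mul, abs_of_pos (inv_pos.2 hn'), inv_mul_le_iff₀ hn']
  calc |∑ i, f (S i)| ≤ ∑ i, |f (S i)| := Finset.abs_sum_le_sum_abs _ _
    _ ≤ ∑ _i : Fin n, M := Finset.sum_le_sum fun i _ => hf _
    _ = n * M := by simp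

section meanDeviation

variable {X : Type*} [MeasurableSpace X] {n : ℕ} (P : Measure X)

theorem meanDeviation_add (S : Fin n → X) {f g : X → ℝ} (hf : Integrable f P)
    (hg : Integrable g P) :
    meanDeviation P S (fun x => f x + g x) = meanDeviation P S f + meanDeviation P S g := by
  simp only [meanDeviation, integral_add hf hg, Finset.sum_add_distrib]
  ring

theorem meanDeviation_sum_mul (S : Fin n → X) {ι : Type*} (T : Finset ι) (a : ι → ℝ)
    {f : ι → X → ℝ} (hf : ∀ t, Integrable (f t) P) :
    meanDeviation P S (fun x => ∑ t ∈ T, a t * f t x)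
      = ∑ t ∈ T, a t * meanDeviation P S (f t) := by
  simp only [meanDeviation, mul_sub, Finset.sum_sub_distrib]
  rw [integral_finsetSum _ fun t _ => (hf t).const_mul _]
  simp only [integral_const_mul]
  congr 1
  rw [Finset.sum_comm, Finset.mul_sum]
  refine Finset.sum_congr rfl fun t _ => ?_
  rw [← Finset.mul_sum]
  ring

theorem measurable_meanDeviation {f : X → ℝ} (hf : Measurable f) :
    Measurable fun S : Fin n → X => meanDeviation P S f := by
  unfold meanDeviation
  fun_prop

variable [IsProbabilityMeasure P]

theorem abs_meanDeviation_le (hn : 0 < n) (S : Fin n → X) {f : X → ℝ} {M : ℝ}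
    (hf : ∀ x, |f x| ≤ M) : |meanDeviation P S f| ≤ 2 * M := by
  have h1 := abs_integral_le_of_abs_le P hf
  have h2 := abs_empirical_mean_le hn S hf
  unfold meanDeviation
  rw [abs_le] at *
  constructor <;> linarith

theorem meanDeviation_const (hn : 0 < n) (S : Fin n → X) (a : ℝ) :
    meanDeviation P S (fun _ => a) = 0 := by
  have hn' : (n : ℝ) ≠ 0 := by exact_mod_cast hn.ne'
  simp [meanDeviation, hn']

/-- This is the variance of an average of `n` independent indicators. Keeping the factor `P.real A`
matters: over disjoint cells these bounds sum to at most `1 / n`. -/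
theorem integral_meanDeviation_sq_le (hn : 0 < n) {A : Set X} (hA : MeasurableSet A) :
    ∫ S, meanDeviation P S (A.indicator 1) ^ 2 ∂(Measure.pi fun _ : Fin n => P)
      ≤ P.real A / n := by
  have hn' : (n : ℝ) ≠ 0 := by exact_mod_cast hn.ne'
  set μ := Measure.pi fun _ : Fin n => P with hμ
  set f : X → ℝ := A.indicator 1 with hf
  have hfm : Measurable f := measurable_one.indicator hA
  have hfb : ∀ x, ‖f x‖ ≤ 1 := fun x => by
    by_cases h : x ∈ A <;> simp [hf, h]
  have hf2 : MemLp f 2 P := MemLp.of_bound hfm.aestronglyMeasurable 1 (ae_of_all _ hfb)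
  have hfi : Integrable f P := Integrable.of_bound hfm.aestronglyMeasurable 1 (ae_of_all _ hfb)
  have hcoord : ∀ i : Fin n, ∫ S, f (S i) ∂μ = ∫ x, f x ∂P := fun i =>
    integral_comp_eval (μ := fun _ : Fin n => P) hfm.aestronglyMeasurable
  have hcoordi : ∀ i : Fin n, Integrable (fun S : Fin n → X => f (S i)) μ := fun i =>
    Integrable.of_bound (hfm.comp (measurable_pi_apply i)).aestronglyMeasurable 1
      (ae_of_all _ fun S => hfb _)
  set Y : (Fin n → X) → ℝ := ∑ i, fun S => f (S i) with hY
  have hYS : ∀ S, Y S = ∑ i, f (S i) := fun S => by simp [hY]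
  have hEY : ∫ S, Y S ∂μ = n * ∫ x, f x ∂P := by
    simp_rw [hYS]
    rw [integral_finsetSum _ fun i _ => hcoordi i]
    simp [hcoord]
  have hYm : Measurable Y := by
    have : Y = fun S => ∑ i, f (S i) := funext hYS
    rw [this]
    exact Finset.measurable_fun_sum _ fun i _ => hfm.comp (measurable_pi_apply i)
  have hvar : ProbabilityTheory.variance Y μ = n * ProbabilityTheory.variance f P := by
    rw [hY, ProbabilityTheory.variance_sum_pi fun _ => hf2]
    simp
  have hvarf : ProbabilityTheory.variance f P ≤ P.real A := by
    refine (ProbabilityTheory.variance_le_expectation_sq hfm.aestronglyMeasurable).trans_eq ?_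
    have : f ^ 2 = f := by
      ext x
      by_cases h : x ∈ A <;> simp [hf, h]
    rw [this, hf, integral_indicator_one hA]
  calc ∫ S, meanDeviation P S f ^ 2 ∂μ
      = ∫ S, (n : ℝ)⁻¹ ^ 2 * (Y S - ∫ S, Y S ∂μ) ^ 2 ∂μ := by
        congr 1 with S
        rw [hEY, hYS, meanDeviation]
        field_simp
        ring
    _ = (n : ℝ)⁻¹ ^ 2 * ProbabilityTheory.variance Y μ := by
        rw [integral_const_mul, ProbabilityTheory.variance_eq_integral hYm.aemeasurable]
    _ = ProbabilityTheory.variance f P / n := by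
        rw [hvar]
        field_simp
    _ ≤ _ := by gcongr

theorem integral_le_sqrt_integral_sq {Ω : Type*} [MeasurableSpace Ω] (μ : Measure Ω)
    [IsProbabilityMeasure μ] {f : Ω → ℝ} (hf : MemLp f 2 μ) :
    ∫ x, f x ∂μ ≤ √(∫ x, f x ^ 2 ∂μ) := by
  refine Real.le_sqrt_of_sq_le ?_
  have h := ProbabilityTheory.variance_nonneg f μ
  rw [ProbabilityTheory.variance_eq_sub hf] at h
  simpa using h

/-- The empirical measure of a finite partition into `T.card` cells has expected total variation
distance `O(√(T.card / n))` to the true one. -/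
theorem integral_sum_abs_meanDeviation_le (hn : 0 < n) (s : SimpleFunc X X) (T : Finset X) :
    ∫ S, ∑ t ∈ T, |meanDeviation P S ((s ⁻¹' {t}).indicator 1)|
        ∂(Measure.pi fun _ : Fin n => P) ≤ √(T.card / n) := by
  set μ := Measure.pi fun _ : Fin n => P with hμ
  have hm : ∀ t, Measurable fun S : Fin n → X =>
      meanDeviation P S ((s ⁻¹' {t}).indicator 1) := fun t =>
    measurable_meanDeviation P (measurable_one.indicator (s.measurableSet_fiber t))
  have hb : ∀ t (S : Fin n → X), |meanDeviation P S ((s ⁻¹' {t}).indicator 1)| ≤ 2 * 1 :=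
    fun t S => abs_meanDeviation_le P hn S fun x => by
      by_cases h : x ∈ s ⁻¹' {t} <;> simp [h]
  have hi : ∀ t, Integrable (fun S : Fin n → X =>
      meanDeviation P S ((s ⁻¹' {t}).indicator 1) ^ 2) μ := fun t =>
    Integrable.of_bound ((hm t).pow_const 2).aestronglyMeasurable ((2 * 1) ^ 2)
      (ae_of_all _ fun S => by
        rw [norm_pow, Real.norm_eq_abs]
        exact pow_le_pow_left₀ (abs_nonneg _) (hb t S) 2)
  have hmsum : Measurable fun S : Fin n → X =>
      ∑ t ∈ T, |meanDeviation P S ((s ⁻¹' {t}).indicator 1)| :=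
    Finset.measurable_fun_sum _ fun t _ => (hm t).abs
  have hL2 : MemLp (fun S : Fin n → X =>
      ∑ t ∈ T, |meanDeviation P S ((s ⁻¹' {t}).indicator 1)|) 2 μ := by
    refine MemLp.of_bound hmsum.aestronglyMeasurable (∑ t ∈ T, 2 * 1) (ae_of_all _ fun S => ?_)
    rw [Real.norm_of_nonneg (Finset.sum_nonneg fun t _ => abs_nonneg _)]
    exact Finset.sum_le_sum fun t _ => hb t S
  refine (integral_le_sqrt_integral_sq μ hL2).trans (Real.sqrt_le_sqrt ?_)
  -- Cauchy–Schwarz over the cells, whose probabilities then sum to at most one.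
  calc ∫ S, (∑ t ∈ T, |meanDeviation P S ((s ⁻¹' {t}).indicator 1)|) ^ 2 ∂μ
      ≤ ∫ S, T.card * ∑ t ∈ T, meanDeviation P S ((s ⁻¹' {t}).indicator 1) ^ 2 ∂μ := by
        refine integral_mono hL2.integrable_sq
          ((integrable_finsetSum _ fun t _ => hi t).const_mul _) fun S => ?_
        simpa using sq_sum_le_card_mul_sum_sq (s := T)
          (f := fun t => |meanDeviation P S ((s ⁻¹' {t}).indicator 1)|)
    _ = T.card * ∑ t ∈ T, ∫ S, meanDeviation P S ((s ⁻¹' {t}).indicator 1) ^ 2 ∂μ := by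
        rw [integral_const_mul, integral_finsetSum _ fun t _ => hi t]
    _ ≤ T.card * ∑ t ∈ T, P.real (s ⁻¹' {t}) / n := by
        gcongr with t _
        exact integral_meanDeviation_sq_le P hn (s.measurableSet_fiber t)
    _ ≤ T.card * (1 / n) := by
        rw [← Finset.sum_div]
        gcongr
        rw [← measureReal_biUnion_finset]
        · exact measureReal_le_one
        · intro a _ b _ hab
          exact Disjoint.preimage _ (by simpa using hab)
        · exact fun t _ => s.measurableSet_fiber t
    _ = T.card / n := by ring

/-- `g ∘ s` is a combination of cell indicators with coefficients bounded by `M`. Apart from `M`,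
the bound does not involve `g`, hence it is uniform over a function class. -/
theorem abs_meanDeviation_comp_simpleFunc_le (S : Fin n → X) (s : SimpleFunc X X) (T : Finset X)
    (hs : ∀ x, s x ∈ T) (g : X → ℝ) {M : ℝ} (hg : ∀ t ∈ T, |g t| ≤ M) :
    |meanDeviation P S (fun x => g (s x))|
      ≤ M * ∑ t ∈ T, |meanDeviation P S ((s ⁻¹' {t}).indicator 1)| := by
  classical
  have h : (fun x => g (s x))
      = fun x => ∑ t ∈ T, g t * (s ⁻¹' {t}).indicator (1 : X → ℝ) x := by
    ext x
    rw [Finset.sum_eq_single_of_mem (s x) (hs x)]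
    · simp
    · intro t _ ht
      simp [ht.symm]
  rw [h, meanDeviation_sum_mul P S T g (f := fun t => (s ⁻¹' {t}).indicator 1) fun t =>
    (integrable_const (1 : ℝ)).indicator (s.measurableSet_fiber t), Finset.mul_sum]
  refine (Finset.abs_sum_le_sum_abs _ _).trans (Finset.sum_le_sum fun t ht => ?_)
  rw [abs_mul]
  gcongr
  exact hg t ht

theorem integrable_sum_abs_meanDeviation (hn : 0 < n) (s : SimpleFunc X X) (T : Finset X) :
    Integrable (fun S : Fin n → X => ∑ t ∈ T, |meanDeviation P S ((s ⁻¹' {t}).indicator 1)|)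
      (Measure.pi fun _ : Fin n => P) := by
  refine integrable_finsetSum _ fun t _ => Integrable.abs ?_
  refine Integrable.of_bound (C := 2 * 1) (measurable_meanDeviation P
    (measurable_one.indicator (s.measurableSet_fiber t))).aestronglyMeasurable
    (ae_of_all _ fun S => abs_meanDeviation_le P hn S fun x => ?_)
  by_cases h : x ∈ s ⁻¹' {t} <;> simp [h]

end meanDeviation

/-! ### Chaining over nets -/

section chaining

variable {X : Type*} [PseudoMetricSpace X] [MeasurableSpace X] (P : Measure X)
  [IsProbabilityMeasure P] {n : ℕ}

/-- Chaining over successive quantizations, for functions that factor through the net `T J`. -/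
theorem exists_chaining_bound_comp_simpleFunc (hn : 0 < n) {T : ℕ → Finset X} {ε : ℕ → ℝ}
    (hT : (T 0).card ≤ 1) (hcov : ∀ j x, ∃ t ∈ T j, dist x t ≤ ε j) (K : ℝ≥0) (J : ℕ) :
    ∀ s : SimpleFunc X X, (∀ x, s x ∈ T J) →
      ∃ W : (Fin n → X) → ℝ, Integrable W (Measure.pi fun _ : Fin n => P) ∧
        ∫ S, W S ∂(Measure.pi fun _ : Fin n => P)
          ≤ K * ∑ j ∈ Finset.range J, ε j * √((T (j + 1)).card / n) ∧
        ∀ S (f : X → ℝ), LipschitzWith K f → |meanDeviation P S (fun x => f (s x))| ≤ W S := by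
  have hε : ∀ j, 0 ≤ ε j := fun j => by
    obtain ⟨x⟩ := nonempty_of_isProbabilityMeasure P
    obtain ⟨t, _, ht⟩ := hcov j x
    exact dist_nonneg.trans ht
  induction J with
  | zero =>
    intro s hs
    -- The coarsest net has a single point, so `f ∘ s` is constant and has no deviation.
    refine ⟨fun _ => 0, integrable_zero _ _ _, by simp, fun S f _ => ?_⟩
    obtain ⟨x₀⟩ := nonempty_of_isProbabilityMeasure P
    have h : (fun x => f (s x)) = fun _ => f (s x₀) := by
      ext x
      rw [Finset.card_le_one.1 hT _ (hs x) _ (hs x₀)]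
    rw [h, meanDeviation_const P hn, abs_zero]
  | succ J ih =>
    intro s hs
    -- `q` sends each point to a nearby one of the coarser net. Then `f ∘ s` splits into `f ∘ q ∘
    -- s`, covered by induction, and an increment bounded by `K * ε J`.
    choose q hqT hq using hcov J
    obtain ⟨W, hWi, hWe, hW⟩ := ih (s.map q) fun x => by simpa using hqT (s x)
    refine ⟨fun S => K * ε J * ∑ t ∈ T (J + 1), |meanDeviation P S ((s ⁻¹' {t}).indicator 1)|
        + W S, ((integrable_sum_abs_meanDeviation P hn s _).const_mul _).add hWi, ?_, ?_⟩
    · rw [integral_add ((integrable_sum_abs_meanDeviation P hn s _).const_mul _) hWi,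
        integral_const_mul, Finset.sum_range_succ, mul_add, add_comm (_ * _), mul_assoc]
      have h := integral_sum_abs_meanDeviation_le P hn s (T (J + 1))
      have := hε J
      gcongr
    · intro S f hf
      have h1 := abs_meanDeviation_comp_simpleFunc_le P S s (T (J + 1)) hs
        (fun t => f t - f (q t)) (M := K * ε J) fun t _ =>
          (hf.dist_le_mul t (q t)).trans (by gcongr; exact hq t)
      have h2 := hW S f hf
      have h3 : meanDeviation P S (fun x => f (s x))
          = meanDeviation P S (fun x => f (s x) - f (q (s x)))
            + meanDeviation P S (fun x => f (s.map q x)) := by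
        rw [← meanDeviation_add]
        · simp
        · exact ((s.map fun t => f t - f (q t)).integrable_of_isFiniteMeasure)
        · exact (((s.map q).map f).integrable_of_isFiniteMeasure)
      rw [h3]
      exact (abs_add_le _ _).trans (add_le_add h1 h2)

/-- Chaining bound for the uniform deviation between expectations and empirical means over all
`K`-Lipschitz functions, in terms of a sequence of finite nets. -/
theorem exists_chaining_bound [OpensMeasurableSpace X] (hn : 0 < n) {T : ℕ → Finset X}
    {ε : ℕ → ℝ} (hT : (T 0).card ≤ 1) (hcov : ∀ j x, ∃ t ∈ T j, dist x t ≤ ε j) (K : ℝ≥0)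
    (J : ℕ) :
    ∃ W : (Fin n → X) → ℝ, Integrable W (Measure.pi fun _ : Fin n => P) ∧
      ∫ S, W S ∂(Measure.pi fun _ : Fin n => P)
        ≤ K * (2 * ε J + ∑ j ∈ Finset.range J, ε j * √((T (j + 1)).card / n)) ∧
      ∀ S (f : X → ℝ), Integrable f P → LipschitzWith K f → |meanDeviation P S f| ≤ W S := by
  obtain ⟨x₀⟩ := nonempty_of_isProbabilityMeasure P
  obtain ⟨t₀, ht₀, -⟩ := hcov J x₀
  -- `SimpleFunc.nearestPt` takes a sequence and uses indices up to and including its bound. Padding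
  -- with `t₀ ∈ T J` keeps the extra index harmless.
  set e : ℕ → X := fun i => (T J).toList.getD i t₀ with he
  have heT : ∀ i, e i ∈ T J := by
    intro i
    by_cases hi : i < (T J).toList.length
    · rw [he]
      simp only [List.getD_eq_getElem _ _ hi]
      exact Finset.mem_toList.1 (List.getElem_mem hi)
    · rw [he]
      simp only [List.getD_eq_default _ _ (not_lt.1 hi)]
      exact ht₀
  set s : SimpleFunc X X := SimpleFunc.nearestPt e (T J).toList.length with hs
  have hsT : ∀ x, s x ∈ T J := fun x => heT _
  have hsd : ∀ x, dist x (s x) ≤ ε J := by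
    intro x
    obtain ⟨t, ht, hxt⟩ := hcov J x
    obtain ⟨i, hi, rfl⟩ := List.getElem_of_mem (Finset.mem_toList.2 ht)
    have h := SimpleFunc.edist_nearestPt_le e x hi.le
    rw [edist_dist, edist_dist, ENNReal.ofReal_le_ofReal_iff dist_nonneg] at h
    have hei : e i = (T J).toList[i] := List.getD_eq_getElem _ _ hi
    rw [hei] at h
    rw [dist_comm] at h hxt
    exact h.trans hxt
  obtain ⟨W, hWi, hWe, hW⟩ := exists_chaining_bound_comp_simpleFunc P hn hT hcov K J s hsT
  -- The factor 2 arises because quantization perturbs both the expectation and the empirical mean.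
  refine ⟨fun S => 2 * (K * ε J) + W S, (integrable_const _).add hWi, ?_, ?_⟩
  · rw [integral_add (integrable_const _) hWi]
    simp only [integral_const, probReal_univ, smul_eq_mul, one_mul]
    linarith
  · intro S f hfi hf
    have hsi : Integrable (fun x => f (s x)) P := (s.map f).integrable_of_isFiniteMeasure
    have h1 : |meanDeviation P S (fun x => f x - f (s x))| ≤ 2 * (K * ε J) :=
      abs_meanDeviation_le P hn S fun x => (hf.dist_le_mul x (s x)).trans (by gcongr; exact hsd x)
    have h3 := meanDeviation_add P S (hfi.sub hsi) hsi
    simp only [Pi.sub_apply, sub_add_cancel] at h3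
    rw [h3]
    exact (abs_add_le _ _).trans (add_le_add h1 (hW S f hf))

end chaining

/-! ### Regularity of the loss and of the uniform deviation -/

theorem lipschitzWith_lossFn {k ℓ : ℕ} {L : ℝ≥0} {h : UnitBall k → UnitBall ℓ}
    (hh : h ∈ lipClass k ℓ L) : LipschitzWith (2 * max L 1) (lossFn h) := by
  refine LipschitzWith.of_dist_le_mul fun z w => ?_
  have hL : (L : ℝ) ≤ ((max L 1 : ℝ≥0) : ℝ) := NNReal.coe_le_coe.2 (le_max_left _ _)
  have h1 : (1 : ℝ) ≤ ((max L 1 : ℝ≥0) : ℝ) :=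
    NNReal.one_le_coe.2 (le_max_right _ _)
  have hx : dist (h z.1) (h w.1) ≤ (max L 1 : ℝ≥0) * dist z w :=
    ((show LipschitzWith L h from hh).dist_le_mul _ _).trans
      (mul_le_mul hL (le_max_left _ _) dist_nonneg (NNReal.coe_nonneg _))
  have hy : dist z.2 w.2 ≤ (max L 1 : ℝ≥0) * dist z w := by
    calc dist z.2 w.2 ≤ 1 * dist z w := by rw [one_mul]; exact le_max_right _ _
      _ ≤ _ := mul_le_mul_of_nonneg_right h1 dist_nonneg
  rw [Subtype.dist_eq] at hx hy
  have := dist_dist_dist_le (h z.1 : EuclideanSpace ℝ (Fin ℓ)) z.2 (h w.1) w.2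
  simp only [lossFn, ← dist_eq_norm]
  push_cast at hx hy ⊢
  linarith

theorem abs_risk_sub_empRisk_le_uniformDeviation {k ℓ n : ℕ}
    (P : Measure (UnitBall k × UnitBall ℓ)) [IsProbabilityMeasure P] {L : ℝ≥0}
    (S : Fin n → UnitBall k × UnitBall ℓ) {h : UnitBall k → UnitBall ℓ}
    (hh : h ∈ lipClass k ℓ L) : |risk P h - empRisk S h| ≤ uniformDeviation P L S :=
  le_csSup (bddAbove_deviation P L S) ⟨h, hh, rfl⟩

theorem uniformDeviation_le {k ℓ n : ℕ} {P : Measure (UnitBall k × UnitBall ℓ)} {L : ℝ≥0}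
    {S : Fin n → UnitBall k × UnitBall ℓ} {a : ℝ}
    (ha : ∀ h ∈ lipClass k ℓ L, |risk P h - empRisk S h| ≤ a) : uniformDeviation P L S ≤ a :=
  csSup_le ((lipClass_nonempty k ℓ L).image _) (by rintro _ ⟨h, hh, rfl⟩; exact ha h hh)

theorem uniformDeviation_nonneg {k ℓ n : ℕ} (P : Measure (UnitBall k × UnitBall ℓ)) (L : ℝ≥0)
    (S : Fin n → UnitBall k × UnitBall ℓ) : 0 ≤ uniformDeviation P L S :=
  Real.sSup_nonneg (by rintro _ ⟨h, _, rfl⟩; exact abs_nonneg _)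

theorem abs_uniformDeviation_le {k ℓ n : ℕ} (hn : 0 < n) (P : Measure (UnitBall k × UnitBall ℓ))
    [IsProbabilityMeasure P] (L : ℝ≥0) (S : Fin n → UnitBall k × UnitBall ℓ) :
    |uniformDeviation P L S| ≤ 2 * 2 := by
  rw [abs_of_nonneg (uniformDeviation_nonneg P L S)]
  refine uniformDeviation_le fun h _ => abs_meanDeviation_le P hn S fun z => ?_
  rw [abs_of_nonneg (lossFn_nonneg h z)]
  exact lossFn_le_two h z

theorem uniformDeviation_le_add {k ℓ n : ℕ} (P : Measure (UnitBall k × UnitBall ℓ))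
    [IsProbabilityMeasure P] {L : ℝ≥0} {S S' : Fin n → UnitBall k × UnitBall ℓ} {c : ℝ}
    (hc : ∀ h ∈ lipClass k ℓ L, |empRisk S' h - empRisk S h| ≤ c) :
    uniformDeviation P L S ≤ uniformDeviation P L S' + c := by
  refine uniformDeviation_le fun h hh => ?_
  have h1 := abs_sub_le (risk P h) (empRisk S' h) (empRisk S h)
  linarith [hc h hh, abs_risk_sub_empRisk_le_uniformDeviation P S' hh]

theorem abs_empRisk_sub_le {k ℓ n : ℕ} (hn : 0 < n) {L : ℝ≥0}
    (S S' : Fin n → UnitBall k × UnitBall ℓ) {h : UnitBall k → UnitBall ℓ}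
    (hh : h ∈ lipClass k ℓ L) :
    |empRisk S' h - empRisk S h| ≤ (2 * max L 1 : ℝ≥0) * dist S S' := by
  have hn' : (0 : ℝ) < n := by exact_mod_cast hn
  rw [empRisk, empRisk, ← mul_sub, ← Finset.sum_sub_distrib, abs_mul, abs_of_pos (inv_pos.2 hn'),
    inv_mul_le_iff₀ hn']
  calc |∑ i, (lossFn h (S' i) - lossFn h (S i))|
      ≤ ∑ i, |lossFn h (S' i) - lossFn h (S i)| := Finset.abs_sum_le_sum_abs _ _
    _ ≤ ∑ _i : Fin n, (2 * max L 1 : ℝ≥0) * dist S S' := by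
        refine Finset.sum_le_sum fun i _ => ((lipschitzWith_lossFn hh).dist_le_mul _ _).trans ?_
        rw [dist_comm S S']
        gcongr
        exact dist_le_pi_dist _ _ _
    _ = n * ((2 * max L 1 : ℝ≥0) * dist S S') := by simp

/-- Supplies the measurability of a supremum over an uncountable class, needed both for its mean and
for McDiarmid's inequality. -/
theorem continuous_uniformDeviation {k ℓ n : ℕ} (hn : 0 < n)
    (P : Measure (UnitBall k × UnitBall ℓ)) [IsProbabilityMeasure P] (L : ℝ≥0) :
    Continuous fun S : Fin n → UnitBall k × UnitBall ℓ => uniformDeviation P L S :=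
  (LipschitzWith.of_le_add_mul (2 * max L 1) fun S S' =>
    uniformDeviation_le_add P fun _ hh => abs_empRisk_sub_le hn S S' hh).continuous

theorem abs_empRisk_update_sub_le {k ℓ n : ℕ} (S : Fin n → UnitBall k × UnitBall ℓ) (i : Fin n)
    (z : UnitBall k × UnitBall ℓ) (h : UnitBall k → UnitBall ℓ) :
    |empRisk (Function.update S i z) h - empRisk S h| ≤ 2 / n := by
  have hsum : ∑ j, (lossFn h (Function.update S i z j) - lossFn h (S j))
      = lossFn h z - lossFn h (S i) := by
    rw [Finset.sum_eq_single i]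
    · simp
    · intro j _ hj
      simp [Function.update_of_ne hj]
    · simp
  rw [empRisk, empRisk, ← mul_sub, ← Finset.sum_sub_distrib, hsum, abs_mul,
    abs_of_nonneg (by positivity : (0 : ℝ) ≤ (n : ℝ)⁻¹), inv_mul_eq_div]
  gcongr
  rw [abs_le]
  constructor <;>
    linarith [lossFn_nonneg h z, lossFn_nonneg h (S i), lossFn_le_two h z, lossFn_le_two h (S i)]

theorem abs_uniformDeviation_update_sub_le {k ℓ n : ℕ} (P : Measure (UnitBall k × UnitBall ℓ))
    [IsProbabilityMeasure P] (L : ℝ≥0) (S : Fin n → UnitBall k × UnitBall ℓ) (i : Fin n)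
    (z : UnitBall k × UnitBall ℓ) :
    |uniformDeviation P L (Function.update S i z) - uniformDeviation P L S| ≤ 2 / n := by
  have h1 : uniformDeviation P L (Function.update S i z) ≤ uniformDeviation P L S + 2 / n :=
    uniformDeviation_le_add P fun h _ => by
      rw [abs_sub_comm]
      exact abs_empRisk_update_sub_le S i z h
  have h2 : uniformDeviation P L S ≤ uniformDeviation P L (Function.update S i z) + 2 / n :=
    uniformDeviation_le_add P fun h _ => abs_empRisk_update_sub_le S i z h
  rw [abs_le]
  constructor <;> linarith

/-! ### Bound on the expected deviation -/

/-- Nets of the product of two unit balls at all scales `4⁻ʲ`, starting with a single point. -/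
theorem exists_net_sequence_prod_unitBall (k ℓ : ℕ) :
    ∃ T : ℕ → Finset (UnitBall k × UnitBall ℓ), (T 0).card ≤ 1 ∧
      (∀ j, ((T j).card : ℝ) ≤ (3 * 4 ^ j) ^ (k + ℓ)) ∧
      ∀ j x, ∃ t ∈ T j, dist x t ≤ (1 / 4 : ℝ) ^ j := by
  have h : ∀ j : ℕ, ∃ T : Finset (UnitBall k × UnitBall ℓ), (j = 0 → T.card ≤ 1) ∧
      (T.card : ℝ) ≤ (3 * 4 ^ j) ^ (k + ℓ) ∧ ∀ x, ∃ t ∈ T, dist x t ≤ (1 / 4 : ℝ) ^ j := by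
    intro j
    rcases Nat.eq_zero_or_pos j with rfl | hj
    · refine ⟨{(⟨0, by simp⟩, ⟨0, by simp⟩)}, by simp, ?_, fun x => ⟨_, Finset.mem_singleton_self _, ?_⟩⟩
      · simpa using one_le_pow₀ (by norm_num : (1 : ℝ) ≤ 3)
      · rw [pow_zero]
        exact max_le x.1.2 x.2.2
    · obtain ⟨T, hT, hc⟩ := exists_net_prod_unitBall k ℓ (ε := (1 / 4) ^ j) (by positivity)
        (pow_le_one₀ (by norm_num) (by norm_num))
      refine ⟨T, fun h0 => absurd h0 hj.ne', ?_, hc⟩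
      simpa [div_eq_mul_inv] using hT
  choose T h0 hT hc using h
  exact ⟨T, h0 0 rfl, hT, hc⟩

/-- The ratio `3 * 4 ^ (j + 1) / m` is at most one, so its `d`-th power is at most itself. This
removes the dimension from the constant: `N / n ≤ 12 * 4 ^ j / m ^ 2`, and `12 ≤ 4 ^ 2`. -/
theorem sqrt_card_div_le {m N n : ℝ} {d j : ℕ} (hm : 0 < m) (hd : 1 ≤ d)
    (hn : m ^ (d + 1) = n) (hN : N ≤ (3 * 4 ^ (j + 1)) ^ d) (hj : 3 * 4 ^ (j + 1) ≤ m) :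
    √(N / n) ≤ 4 * 2 ^ j / m := by
  refine Real.sqrt_le_iff.2 ⟨by positivity, ?_⟩
  have hq : 3 * 4 ^ (j + 1) / m ≤ 1 := (div_le_one hm).2 hj
  calc N / n ≤ (3 * 4 ^ (j + 1)) ^ d / m ^ (d + 1) := by rw [hn]; gcongr; rw [← hn]; positivity
    _ = (3 * 4 ^ (j + 1) / m) ^ d / m := by rw [div_pow, div_div, pow_succ m]
    _ ≤ (3 * 4 ^ (j + 1) / m) ^ 1 / m := by
        gcongr ?_ / m
        exact pow_le_pow_of_le_one (by positivity) hq hd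
    _ ≤ (4 * 2 ^ j / m) ^ 2 := by
        have h4 : (4 : ℝ) ^ j = (2 ^ j) ^ 2 := by
          rw [← pow_mul, mul_comm, pow_mul]
          norm_num
        have hpos : (0 : ℝ) < 2 ^ j := by positivity
        rw [pow_succ (4 : ℝ) j, h4, pow_one, div_pow, div_div, ← sq]
        gcongr
        nlinarith

theorem integral_uniformDeviation_le {k ℓ n : ℕ} (hn : 0 < n) (hd : 1 ≤ k + ℓ)
    (P : Measure (UnitBall k × UnitBall ℓ)) [IsProbabilityMeasure P] (L : ℝ≥0) {m : ℝ}
    (hm : 0 < m) (hmn : m ^ (k + ℓ + 1) = n) :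
    ∫ S, uniformDeviation P L S ∂(Measure.pi fun _ : Fin n => P)
      ≤ 64 * (max (L : ℝ) 1 / m) := by
  obtain ⟨T, hT0, hT, hcov⟩ := exists_net_sequence_prod_unitBall k ℓ
  -- For `m ≥ 3`, `J` is the largest exponent with `3 * 4 ^ J ≤ m`, so `4 ^ J > m / 12`. For `m ≤ 3`
  -- no chaining is needed, since `1 ≤ 12 / m`.
  obtain ⟨J, hJ, hJm⟩ : ∃ J : ℕ, (1 / 4 : ℝ) ^ J ≤ 12 / m ∧ ∀ j < J, 3 * 4 ^ (j + 1) ≤ m := by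
    rcases le_total 3 m with h3 | h3
    · obtain ⟨J, h1, h2⟩ := exists_nat_pow_near (x := m / 3) (y := 4) (by linarith) (by norm_num)
      refine ⟨J, ?_, fun j hj => ?_⟩
      · rw [one_div, inv_pow, inv_le_comm₀ (by positivity) (by positivity), inv_div]
        rw [pow_succ] at h2
        linarith
      · have : (4 : ℝ) ^ (j + 1) ≤ 4 ^ J := pow_le_pow_right₀ (by norm_num) hj
        linarith
    · refine ⟨0, ?_, by simp⟩
      rw [pow_zero, le_div_iff₀ hm]
      linarith
  obtain ⟨W, hWi, hWe, hW⟩ := exists_chaining_bound P hn hT0 hcov (2 * max L 1) J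
  have hsum : ∑ j ∈ Finset.range J, (1 / 4 : ℝ) ^ j * √((T (j + 1)).card / n) ≤ 8 / m := by
    calc _ ≤ ∑ j ∈ Finset.range J, 4 / m * (1 / 2 : ℝ) ^ j := by
          refine Finset.sum_le_sum fun j hj => ?_
          have h := sqrt_card_div_le hm hd hmn (hT (j + 1)) (hJm j (Finset.mem_range.1 hj))
          calc _ ≤ (1 / 4 : ℝ) ^ j * (4 * 2 ^ j / m) := by gcongr
            _ = 4 / m * ((1 / 4) ^ j * 2 ^ j) := by ring
            _ = _ := by rw [← mul_pow]; norm_num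
      _ = 4 / m * ∑ j ∈ Finset.range J, (1 / 2 : ℝ) ^ j := by rw [Finset.mul_sum]
      _ ≤ 4 / m * 2 := by
          gcongr
          exact sum_geometric_two_le J
      _ = 8 / m := by ring
  have hGi : Integrable (fun S : Fin n → UnitBall k × UnitBall ℓ => uniformDeviation P L S)
      (Measure.pi fun _ : Fin n => P) :=
    Integrable.of_bound (continuous_uniformDeviation hn P L).aestronglyMeasurable (2 * 2)
      (ae_of_all _ fun S => abs_uniformDeviation_le hn P L S)
  calc _ ≤ ∫ S, W S ∂(Measure.pi fun _ : Fin n => P) :=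
        integral_mono hGi hWi fun S => uniformDeviation_le fun h hh =>
          hW S (lossFn h) (integrable_lossFn P hh) (lipschitzWith_lossFn hh)
    _ ≤ _ := hWe
    -- The constant 64 is `2 * (24 + 8)`.
    _ ≤ ((2 * max L 1 : ℝ≥0) : ℝ) * (2 * (12 / m) + 8 / m) := by gcongr
    _ = _ := by
        push_cast
        ring

/-! ### High-probability bound -/

theorem uniformDeviation_eq_zero_of_dim_zero {n : ℕ} (P : Measure (UnitBall 0 × UnitBall 0))
    (L : ℝ≥0) (S : Fin n → UnitBall 0 × UnitBall 0) : uniformDeviation P L S = 0 := by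
  refine le_antisymm (uniformDeviation_le fun h _ => ?_) (uniformDeviation_nonneg P L S)
  have hz : ∀ z, lossFn h z = 0 := fun z => by
    rw [lossFn, Subsingleton.elim (h z.1 : EuclideanSpace ℝ (Fin 0)) z.2, sub_self, norm_zero]
  simp [risk, empRisk, hz]

theorem measure_uniformDeviation_ge_le {k ℓ n : ℕ} (hn : 0 < n)
    (P : Measure (UnitBall k × UnitBall ℓ)) [IsProbabilityMeasure P] (L : ℝ≥0) {δ : ℝ}
    (hδ : 0 < δ) (hδ1 : δ < 1) :
    (Measure.pi fun _ : Fin n => P).real {S | 6 * √(Real.log (2 / δ) / (2 * n))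
      ≤ uniformDeviation P L S
        - ∫ S', uniformDeviation P L S' ∂(Measure.pi fun _ : Fin n => P)} ≤ δ := by
  have hn' : (0 : ℝ) < n := by exact_mod_cast hn
  have hlog : 0 ≤ Real.log (2 / δ) := Real.log_nonneg (by rw [le_div_iff₀ hδ]; linarith)
  refine (measureReal_ge_le_of_bounded_differences P (by positivity)
    (continuous_uniformDeviation hn P L).measurable (abs_uniformDeviation_le hn P L)
    (abs_uniformDeviation_update_sub_le P L) (by positivity)).trans ?_
  -- With differences `c = 2 / n` the factor 6 yields nine times the required exponent; a factor 2
  -- would already suffice.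
  have he : -(6 * √(Real.log (2 / δ) / (2 * n))) ^ 2 / (2 * (n * (2 / n / 2) ^ 2))
      = -(9 * Real.log (2 / δ)) := by
    rw [mul_pow, Real.sq_sqrt (by positivity)]
    field_simp
    ring
  rw [he]
  calc Real.exp (-(9 * Real.log (2 / δ))) ≤ Real.exp (-Real.log (2 / δ)) :=
        Real.exp_le_exp.2 (by linarith)
    _ = δ / 2 := by rw [Real.exp_neg, Real.exp_log (by positivity), inv_div]
    _ ≤ δ := by linarith

theorem mainTheorem5 :
    ∃ C : ℝ, 0 < C ∧
      ∀ (k ℓ n : ℕ) (L : ℝ≥0) (P : Measure (UnitBall k × UnitBall ℓ)) (δ : ℝ),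
        1 ≤ n → IsProbabilityMeasure P → 0 < δ → δ < 1 →
          (Measure.pi fun _ : Fin n => P)
              {S | C * (max (L : ℝ) 1 / (n : ℝ) ^ ((1 : ℝ) / ((k : ℝ) + (ℓ : ℝ) + 1)))
                    + 6 * Real.sqrt (Real.log (2 / δ) / (2 * (n : ℝ)))
                  < uniformDeviation P L S} ≤ ENNReal.ofReal δ := by
  refine ⟨64, by norm_num, fun k ℓ n L P δ hn hP hδ hδ1 => ?_⟩
  have hn' : (0 : ℝ) < n := by exact_mod_cast hn
  set m : ℝ := (n : ℝ) ^ ((1 : ℝ) / ((k : ℝ) + (ℓ : ℝ) + 1)) with hm_def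
  have hm : 0 < m := Real.rpow_pos_of_pos hn' _
  -- Dimension zero is separate because the chaining estimate needs `d ≥ 1`; there the deviation
  -- vanishes and the bad event is empty.
  rcases Nat.eq_zero_or_pos (k + ℓ) with hd | hd
  · obtain ⟨rfl, rfl⟩ : k = 0 ∧ ℓ = 0 := by omega
    refine (measure_mono_null (fun S hS => ?_) measure_empty).trans_le zero_le
    simp only [Set.mem_ofPred_eq, uniformDeviation_eq_zero_of_dim_zero] at hS
    exact absurd hS (not_lt.2 (by positivity))
  · have hmn : m ^ (k + ℓ + 1) = n := by
      have h : (1 : ℝ) / ((k : ℝ) + (ℓ : ℝ) + 1) = ((k + ℓ + 1 : ℕ) : ℝ)⁻¹ := by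
        push_cast
        rw [one_div]
      rw [hm_def, h, Real.rpow_inv_natCast_pow hn'.le (by omega)]
    have hE := integral_uniformDeviation_le hn hd P L hm hmn
    refine (measure_mono (fun S hS => ?_)).trans
      (ENNReal.le_ofReal_iff_toReal_le (measure_ne_top _ _) hδ.le |>.2
        (measure_uniformDeviation_ge_le hn P L hδ hδ1))
    simp only [Set.mem_ofPred_eq] at hS ⊢
    linarith
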